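/- All rings are associative with $1$; modules are unital. Let $A$ be a ring. A right $A$-module homomorphism $f\colon C\to M$ is a \emph{G-flat cover} of $M$ if $C$ is flat, $f$ is onto, and $\ker f$ is a small submodule of $C$ (that is, $\ker f+N=C$ for a submodule $N\le C$ implies $N=C$). It is a \emph{flat cover} if $C$ is flat, every homomorphism $C'\to M$ with $C'$ flat factors through $f$, and every endomorphism $g$ of $C$ with $fg=f$ is bijective. The ring $A$ is \emph{right G-perfect} if every right $A$-module has a G-flat cover; the left-hand notions are analogous, and $A$ is \emph{G-perfect} if it is left and right G-perfect. It is \emph{semiprimitive} if its Jacobson radical $J(A)$ is $0$, and \emph{von Neumann regular} if for every $a\in A$ there is $x\in A$ with $axa=a$. For a subring $B\subseteq A$ put $$E(B\subseteq A)=\{(x_1,\dots,x_k,x,x,\dots)\mid k\in\mathbb N,\ x_i\in A,\ x\in B\}\subseteq A^{\mathbb N}.$$ Let $F$ be a field and let $S$ be a finite-dimensional (associative, unital) $F$-algebra with $J(S)\neq 0$. Then $S$ embeds as an $F$-algebra in $M_n(F)$ for $n=\dim_F S$. Moreover, for every $n$ and every embedding of $F$-algebras $S\hookrightarrow T=M_n(F)$: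 (a) The ring $R=E(S\subseteq T)$ is G-perfect and semiprimitive, and it is not von Neumann regular. In particular $R/J(R)$ is not von Neumann regular, so a G-perfect ring need not be von Neumann regular modulo its Jacobson radical (a negative answer to the question of Amini, Amini, Ershad and Sharif). Moreover every right and every left $R$-module has a flat cover, and every flat cover is a G-flat cover. (b) Let $T'=T^{\mathbb N}$, so that $R$ is a subring of $T'$. All the assertions of (a) hold for $R'=E(R\subseteq T')$ in place of $R$. In particular, the algebra $S$ of upper triangular $2\times 2$ matrices over $F$ satisfies $J(S)\ne0$, and (a) and (b) hold for the inclusion $S\subseteq T=M_2(F)$. -/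

import Mathlib

open scoped TensorProduct

universe u v w

/-!
Modules over a possibly noncommutative ring `R` are left modules, as always in Mathlib.
A right `R`-module is a module over the opposite ring `Rᵐᵒᵖ`, so that each right-handed
notion for `R` is the corresponding left-handed notion for `Rᵐᵒᵖ`.
-/

section Flat

variable (R : Type*) [Ring R]

/-- The subgroup of `P ⊗[ℤ] M` generated by all `(p r) ⊗ m - p ⊗ (r m)`. -/
def balancedRelations (P M : Type*) [AddCommGroup P] [Module Rᵐᵒᵖ P]
    [AddCommGroup M] [Module R M] : AddSubgroup (P ⊗[ℤ] M) :=
  AddSubgroup.closure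
    {z | ∃ (p : P) (r : R) (m : M), z = (MulOpposite.op r • p) ⊗ₜ[ℤ] m - p ⊗ₜ[ℤ] (r • m)}

/-- The tensor product `P ⊗_R M` (an abelian group) of a right `R`-module `P` and a left
`R`-module `M` over a possibly noncommutative ring `R`. -/
abbrev BalancedTensor (P M : Type*) [AddCommGroup P] [Module Rᵐᵒᵖ P]
    [AddCommGroup M] [Module R M] : Type _ :=
  (P ⊗[ℤ] M) ⧸ balancedRelations R P M

variable {R} in
/-- The homomorphism `f ⊗ id : P ⊗_R M → Q ⊗_R M` induced by a homomorphism `f : P → Q` of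
right `R`-modules. -/
def BalancedTensor.map {P Q : Type*} (M : Type*) [AddCommGroup P] [Module Rᵐᵒᵖ P]
    [AddCommGroup Q] [Module Rᵐᵒᵖ Q] [AddCommGroup M] [Module R M] (f : P →ₗ[Rᵐᵒᵖ] Q) :
    BalancedTensor R P M →+ BalancedTensor R Q M :=
  QuotientAddGroup.map (balancedRelations R P M) (balancedRelations R Q M)
    (LinearMap.rTensor M f.toAddMonoidHom.toIntLinearMap).toAddMonoidHom (by
      refine (AddSubgroup.closure_le _).2 ?_
      rintro _ ⟨p, r, m, rfl⟩
      refine AddSubgroup.subset_closure ⟨f p, r, m, ?_⟩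
      rw [map_sub]
      exact congrArg (fun q => q ⊗ₜ[ℤ] m - f p ⊗ₜ[ℤ] (r • m)) (map_smul f (MulOpposite.op r) p))

end Flat

/-- A left `R`-module `M` is flat if `- ⊗_R M` preserves injectivity of homomorphisms of right
`R`-modules. As for Mathlib's `Module.Flat`, the test modules live in the universe of `R`; this
includes all right ideals of `R` and hence is no restriction. -/
def IsFlatModule (R : Type u) [Ring R] (M : Type v) [AddCommGroup M] [Module R M] : Prop :=
  ∀ (P Q : Type u) [AddCommGroup P] [Module Rᵐᵒᵖ P] [AddCommGroup Q] [Module Rᵐᵒᵖ Q]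
    (f : P →ₗ[Rᵐᵒᵖ] Q), Function.Injective f → Function.Injective (BalancedTensor.map M f)

section Covers

variable {R : Type u} [Ring R]

/-- A small (superfluous) submodule. -/
def IsSmallSubmodule {M : Type v} [AddCommGroup M] [Module R M] (K : Submodule R M) : Prop :=
  ∀ N : Submodule R M, K ⊔ N = ⊤ → N = ⊤

/-- `f : C → M` is a G-flat cover: `C` is flat and `f` is an epimorphism with small kernel. -/
structure IsGFlatCover {C M : Type v} [AddCommGroup C] [Module R C] [AddCommGroup M] [Module R M]
    (f : C →ₗ[R] M) : Prop where
  flat : IsFlatModule R C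
  surjective : Function.Surjective f
  small_ker : IsSmallSubmodule (LinearMap.ker f)

/-- `f : C → M` is a flat cover in the sense of Enochs: a right minimal flat precover. -/
structure IsFlatCover {C M : Type v} [AddCommGroup C] [Module R C] [AddCommGroup M] [Module R M]
    (f : C →ₗ[R] M) : Prop where
  flat : IsFlatModule R C
  precover : ∀ (C' : Type v) [AddCommGroup C'] [Module R C'], IsFlatModule R C' →
    ∀ g : C' →ₗ[R] M, ∃ h : C' →ₗ[R] C, f ∘ₗ h = g
  minimal : ∀ g : C →ₗ[R] C, f ∘ₗ g = f → Function.Bijective g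

end Covers

/-- `R` is left G-perfect: every left `R`-module has a G-flat cover. The modules range over an
arbitrary universe `max u w` above the universe `u` of `R`. -/
def IsLeftGPerfect (R : Type u) [Ring R] : Prop :=
  ∀ (M : Type (max u w)) [AddCommGroup M] [Module R M],
    ∃ (C : Type (max u w)) (_ : AddCommGroup C) (_ : Module R C) (f : C →ₗ[R] M), IsGFlatCover f

/-- `R` is right G-perfect: every right `R`-module has a G-flat cover. -/
def IsRightGPerfect (R : Type u) [Ring R] : Prop :=
  IsLeftGPerfect.{u, w} Rᵐᵒᵖ

/-- Every left `R`-module has a flat cover, and every flat cover of a left `R`-module is a G-flat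
cover. -/
def LeftFlatCoversAreGFlatCovers (R : Type u) [Ring R] : Prop :=
  ∀ (M : Type (max u w)) [AddCommGroup M] [Module R M],
    (∃ (C : Type (max u w)) (_ : AddCommGroup C) (_ : Module R C) (f : C →ₗ[R] M),
      IsFlatCover f) ∧
    ∀ (C : Type (max u w)) [AddCommGroup C] [Module R C] (f : C →ₗ[R] M),
      IsFlatCover f → IsGFlatCover f

/-- Every right `R`-module has a flat cover, and every flat cover of a right `R`-module is a
G-flat cover. -/
def RightFlatCoversAreGFlatCovers (R : Type u) [Ring R] : Prop :=
  LeftFlatCoversAreGFlatCovers.{u, w} Rᵐᵒᵖ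

/-- Von Neumann regular rings. -/
def IsVonNeumannRegular (R : Type u) [Ring R] : Prop :=
  ∀ a : R, ∃ x : R, a * x * a = a

/-- The ring of all sequences `(x₁, …, xₙ, x, x, …)` with `xᵢ ∈ T` and `x ∈ S`, for a subring `S`
of `T`, as a subring of the ring `T^ℕ` of all sequences in `T`. -/
def eventuallyConstant {T : Type u} [Ring T] (S : Subring T) : Subring (ℕ → T) where
  carrier := {a | ∃ x ∈ S, ∃ n : ℕ, ∀ i, n ≤ i → a i = x}
  mul_mem' := by
    rintro a b ⟨x, hx, n, hn⟩ ⟨y, hy, m, hm⟩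
    refine ⟨x * y, S.mul_mem hx hy, max n m, fun i hi => ?_⟩
    simp [hn i (le_trans (le_max_left n m) hi), hm i (le_trans (le_max_right n m) hi)]
  one_mem' := ⟨1, S.one_mem, 0, fun _ _ => rfl⟩
  add_mem' := by
    rintro a b ⟨x, hx, n, hn⟩ ⟨y, hy, m, hm⟩
    refine ⟨x + y, S.add_mem hx hy, max n m, fun i hi => ?_⟩
    simp [hn i (le_trans (le_max_left n m) hi), hm i (le_trans (le_max_right n m) hi)]
  zero_mem' := ⟨0, S.zero_mem, 0, fun _ _ => rfl⟩
  neg_mem' := by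
    rintro a ⟨x, hx, n, hn⟩
    exact ⟨-x, S.neg_mem hx, n, fun i hi => by simp [hn i hi]⟩

/-- The algebra of upper triangular `2 × 2` matrices over `F`. -/
def upperTriangularTwo (F : Type u) [Field F] : Subalgebra F (Matrix (Fin 2) (Fin 2) F) where
  carrier := {A | A 1 0 = 0}
  mul_mem' := by
    intro A B hA hB
    change A 1 0 = 0 at hA
    change B 1 0 = 0 at hB
    change (A * B) 1 0 = 0
    simp [Matrix.mul_apply, hA, hB]
  add_mem' := by
    intro A B hA hB
    change A 1 0 = 0 at hA
    change B 1 0 = 0 at hB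
    change (A + B) 1 0 = 0
    simp [hA, hB]
  algebraMap_mem' := by
    intro c
    change algebraMap F (Matrix (Fin 2) (Fin 2) F) c 1 0 = 0
    simp [Matrix.algebraMap_matrix_apply]

/-- The properties asserted of the examples: `R` is G-perfect on both sides and semiprimitive, `R`
is not von Neumann regular, nor is `R / J(R)`, and on both sides flat covers are G-flat covers. -/
structure IsGPerfectCounterexample (R : Type u) [Ring R] : Prop where
  leftGPerfect : IsLeftGPerfect.{u, w} R
  rightGPerfect : IsRightGPerfect.{u, w} R
  semiprimitive : Ring.jacobson R = ⊥
  not_regular : ¬ IsVonNeumannRegular R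
  not_regular_mod_jacobson : ¬ IsVonNeumannRegular (R ⧸ Ring.jacobson R)
  left_flatCovers : LeftFlatCoversAreGFlatCovers.{u, w} R
  right_flatCovers : RightFlatCoversAreGFlatCovers.{u, w} R

/-!
The sequences in `E(S ⊆ T)` with eventual value `0` form an ideal `I` with quotient `S`. If `T` is
von Neumann regular, then `I` is a von Neumann regular ideal, and it is the union of the ideals
`e R` for the central idempotents `e ∈ I`. These properties of the map `R → S` are recorded as
`HasRegularKernel`; they are left-right symmetric, so only left modules have to be considered, for
`R` and for its opposite.

Flatness is handled by the equational criterion: a module is flat if and only if all its linear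
relations are trivial (`IsFlatModule.of_relationsTrivial` and `IsFlatModule.relationsTrivial`). It
shows that an `R`-module `M` is flat if and only if the `S`-module `M / I M` is flat
(`RelationsTrivial.reduction`, `RelationsTrivial.of_reduction`), because the part of `M` seen by `I`
is a module over von Neumann regular corner rings. Hence flat covers with small kernel lift from `S`
to `R`: if `P → M / I M` is such a cover, so is the pullback `M ×_{M / I M} P → M`. The maps
`I C → I M` are isomorphisms here, so all that matters happens modulo `I`
(`HasRegularKernel.hasSmallFlatCovers`).

The first step starts from a finite-dimensional algebra `S`. It is semiprimary, so projective covers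
exist (`exists_projective_ker_le_jacobson_smul`) and flat modules are projective
(`RelationsTrivial.projective`); a projective cover is then a flat cover with small kernel. The
second step starts from the ring `R` of the first one, with `T ^ ℕ` in the role of `T`. Since flat
covers are unique up to isomorphism, all of them have small kernel.

Both rings are semiprimitive, because an element of `I J(R)` is von Neumann regular in `R` and lies
in the radical, hence vanishes, and only `0` is annihilated by `I`. Neither is von Neumann regular,
since it maps onto `S`, and a von Neumann regular ring has zero radical.
-/

/-! ### The equational criterion for flatness -/

section EquationalCriterion

/-- The equational criterion for flatness: every linear relation `∑ rᵢ mᵢ = 0` in the left module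
`M` is a consequence of relations `∑ rᵢ bᵢⱼ = 0` in the ring, through `mᵢ = ∑ bᵢⱼ nⱼ`. -/
def RelationsTrivial (R : Type*) [Ring R] (M : Type*) [AddCommGroup M] [Module R M] : Prop :=
  ∀ (k : ℕ) (r : Fin k → R) (m : Fin k → M), ∑ i, r i • m i = 0 →
    ∃ (l : ℕ) (b : Fin k → Fin l → R) (n : Fin l → M),
      (∀ i, m i = ∑ j, b i j • n j) ∧ ∀ j, ∑ i, r i * b i j = 0

variable {R : Type*} [Ring R] {M : Type*} [AddCommGroup M] [Module R M]

theorem RelationsTrivial.exists_of_fintype (h : RelationsTrivial R M) {ι : Type*} [Fintype ι]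
    (r : ι → R) (m : ι → M) (hrm : ∑ i, r i • m i = 0) :
    ∃ (l : ℕ) (b : ι → Fin l → R) (n : Fin l → M),
      (∀ i, m i = ∑ j, b i j • n j) ∧ ∀ j, ∑ i, r i * b i j = 0 := by
  let e := Fintype.equivFin ι
  obtain ⟨l, b, n, h₁, h₂⟩ := h _ (r ∘ e.symm) (m ∘ e.symm)
    (by rw [← hrm]; exact e.symm.sum_comp fun i => r i • m i)
  refine ⟨l, fun i => b (e i), n, fun i => by simpa using h₁ (e i), fun j => ?_⟩
  rw [← h₂ j, ← e.symm.sum_comp]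
  simp

theorem RelationsTrivial.of_exists_fintype
    (h : ∀ (k : ℕ) (r : Fin k → R) (m : Fin k → M), ∑ i, r i • m i = 0 →
      ∃ (κ : Type) (_ : Fintype κ) (b : Fin k → κ → R) (n : κ → M),
        (∀ i, m i = ∑ j, b i j • n j) ∧ ∀ j, ∑ i, r i * b i j = 0) :
    RelationsTrivial R M := by
  intro k r m hrm
  obtain ⟨κ, _, b, n, h₁, h₂⟩ := h k r m hrm
  let e := Fintype.equivFin κ
  refine ⟨_, fun i j => b i (e.symm j), n ∘ e.symm, fun i => ?_, fun j => h₂ _⟩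
  rw [h₁ i]
  exact (e.symm.sum_comp fun j => b i j • n j).symm

/-- Finitely many simultaneous relations are trivial for a common reason. This follows by
adding one relation at a time: a relation between the `mᵢ` turns into one between the `nⱼ`. -/
theorem RelationsTrivial.exists_of_finset (h : RelationsTrivial R M) {ι : Type*} [Fintype ι]
    {κ : Type*} (s : Finset κ) (a : κ → ι → R) (m : ι → M)
    (ham : ∀ k ∈ s, ∑ i, a k i • m i = 0) :
    ∃ (l : ℕ) (b : ι → Fin l → R) (n : Fin l → M),
      (∀ i, m i = ∑ j, b i j • n j) ∧ ∀ k ∈ s, ∀ j, ∑ i, a k i * b i j = 0 := by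
  classical
  induction s using Finset.induction_on with
  | empty =>
    let e := Fintype.equivFin ι
    refine ⟨_, fun i j => if e i = j then 1 else 0, m ∘ e.symm, fun i => ?_, by simp⟩
    simp
  | insert k s _ ih =>
    obtain ⟨l, b, n, h₁, h₂⟩ := ih fun k hk => ham k (Finset.mem_insert_of_mem hk)
    have hk : ∑ j, (∑ i, a k i * b i j) • n j = 0 := by
      rw [← ham k (Finset.mem_insert_self k s)]
      simp_rw [Finset.sum_smul, h₁, Finset.smul_sum, mul_smul]
      exact Finset.sum_comm
    obtain ⟨l', b', n', h₁', h₂'⟩ := h _ _ _ hk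
    refine ⟨l', fun i j' => ∑ j, b i j * b' j j', n', fun i => ?_, fun k' hk' j' => ?_⟩
    · rw [h₁ i]
      simp_rw [h₁', Finset.smul_sum, Finset.sum_smul, mul_smul]
      exact Finset.sum_comm
    · have key : ∑ i, a k' i * ∑ j, b i j * b' j j' = ∑ j, (∑ i, a k' i * b i j) * b' j j' := by
        simp_rw [Finset.mul_sum, Finset.sum_mul, mul_assoc]
        exact Finset.sum_comm
      rw [key]
      rcases Finset.mem_insert.1 hk' with rfl | hk'
      · exact h₂' j'
      · simp [h₂ k' hk']

end EquationalCriterion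

/-! ### Vanishing in a tensor product over a noncommutative ring -/

section Vanishing

variable {R : Type*} [Ring R] {P Q : Type*} [AddCommGroup P] [Module Rᵐᵒᵖ P] [AddCommGroup Q]
  [Module Rᵐᵒᵖ Q] {M : Type*} [AddCommGroup M] [Module R M]

/-- The class of `p ⊗ m` in `P ⊗_R M`, as a homomorphism in `p`. -/
def BalancedTensor.tmulHom (R : Type*) [Ring R] (P : Type*) [AddCommGroup P] [Module Rᵐᵒᵖ P]
    {M : Type*} [AddCommGroup M] [Module R M] (m : M) : P →+ BalancedTensor R P M :=
  (QuotientAddGroup.mk' (balancedRelations R P M)).comp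
    ((TensorProduct.mk ℤ P M).flip m).toAddMonoidHom

theorem BalancedTensor.tmulHom_apply (p : P) (m : M) :
    tmulHom R P m p = QuotientAddGroup.mk' (balancedRelations R P M) (p ⊗ₜ[ℤ] m) := rfl

theorem BalancedTensor.tmulHom_zero (p : P) : tmulHom R P (0 : M) p = 0 := by
  rw [tmulHom_apply, TensorProduct.tmul_zero, map_zero]

theorem BalancedTensor.tmulHom_sum {ι : Type*} (s : Finset ι) (p : P) (m : ι → M) :
    tmulHom R P (∑ i ∈ s, m i) p = ∑ i ∈ s, tmulHom R P (m i) p := by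
  rw [tmulHom_apply, TensorProduct.tmul_sum, map_sum]; rfl

theorem BalancedTensor.tmulHom_smul (p : P) (r : R) (m : M) :
    tmulHom R P (r • m) p = tmulHom R P m (MulOpposite.op r • p) := by
  symm
  rw [← sub_eq_zero, tmulHom_apply, tmulHom_apply, ← map_sub]
  exact (QuotientAddGroup.eq_zero_iff _).2 (AddSubgroup.subset_closure ⟨p, r, m, rfl⟩)

theorem BalancedTensor.map_tmulHom (f : P →ₗ[Rᵐᵒᵖ] Q) (p : P) (m : M) :
    BalancedTensor.map M f (tmulHom R P m p) = tmulHom R Q m (f p) := rfl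

/-- Every element of `P ⊗_R M` is a sum `∑ pₘ ⊗ m` over the elements `m` of `M`. -/
theorem BalancedTensor.exists_finsupp (z : BalancedTensor R P M) :
    ∃ x : M →₀ P, z = x.sum fun m p => tmulHom R P m p := by
  obtain ⟨z, rfl⟩ := QuotientAddGroup.mk'_surjective _ z
  induction z with
  | zero => exact ⟨0, by simp⟩
  | tmul p m => exact ⟨Finsupp.single m p, by simp [tmulHom_apply]⟩
  | add x y hx hy =>
    obtain ⟨a, ha⟩ := hx
    obtain ⟨b, hb⟩ := hy
    refine ⟨a + b, ?_⟩
    rw [map_add, ha, hb, Finsupp.sum_add_index' (fun _ => map_zero _) fun _ => map_add _]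

/-- The family `(p kₘ)ₘ` for an element `p` of a right module and a family `(kₘ)ₘ` in `R`. -/
noncomputable def finsuppSMulHom {R : Type*} [Ring R] (P : Type*) [AddCommGroup P]
    [Module Rᵐᵒᵖ P] {M : Type*} (k : M →₀ R) : P →+ (M →₀ P) where
  toFun p := k.mapRange (fun r => MulOpposite.op r • p) (by simp)
  map_zero' := by ext; simp
  map_add' p q := by ext; simp

@[simp]
theorem finsuppSMulHom_apply {M : Type*} (k : M →₀ R) (p : P) (m : M) :
    finsuppSMulHom P k p m = MulOpposite.op (k m) • p := rfl

/-- The families `(pₘ)ₘ` of the form `∑ⱼ qⱼ kⱼ`, where each `kⱼ` is a relation `∑ₘ kⱼₘ m = 0`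
in `M`. They are the families with `∑ pₘ ⊗ m = 0`. -/
noncomputable def vanishingFamilies (R : Type*) [Ring R] (P M : Type*) [AddCommGroup P]
    [Module Rᵐᵒᵖ P] [AddCommGroup M] [Module R M] : AddSubgroup (M →₀ P) :=
  (Finsupp.liftAddHom fun k : LinearMap.ker (Finsupp.linearCombination R (id : M → M)) =>
    finsuppSMulHom P k.1).range

theorem finsuppSMulHom_mem_vanishingFamilies (k : M →₀ R)
    (hk : Finsupp.linearCombination R (id : M → M) k = 0) (p : P) :
    finsuppSMulHom P k p ∈ vanishingFamilies R P M :=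
  ⟨Finsupp.single ⟨k, hk⟩ p, by simp⟩

/-- The map `P ⊗_R M → (M →₀ P) / V` inverse to `(pₘ)ₘ ↦ ∑ pₘ ⊗ m`, with `V` the subgroup of
vanishing families. -/
noncomputable def toFamilies (R : Type*) [Ring R] (P M : Type*) [AddCommGroup P] [Module Rᵐᵒᵖ P]
    [AddCommGroup M] [Module R M] :
    BalancedTensor R P M →+ (M →₀ P) ⧸ vanishingFamilies R P M :=
  QuotientAddGroup.lift _
    (TensorProduct.liftAddHom
      (AddMonoidHom.mk' (fun p => AddMonoidHom.mk'
          (fun m => QuotientAddGroup.mk' (vanishingFamilies R P M) (Finsupp.single m p)) (by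
            intro m m'
            rw [← sub_eq_zero, ← map_add, ← map_sub, QuotientAddGroup.mk'_apply,
              QuotientAddGroup.eq_zero_iff]
            convert finsuppSMulHom_mem_vanishingFamilies (Finsupp.single (m + m') (1 : R) -
              (Finsupp.single m 1 + Finsupp.single m' 1)) (by simp) p using 1
            classical
            ext x
            simp [Finsupp.single_apply, sub_smul, add_smul, apply_ite MulOpposite.op])) (by
        intro p q
        ext m
        simp [Finsupp.single_add]))
      (by
        intro r p m
        simp only [AddMonoidHom.mk'_apply]
        rw [← sub_eq_zero, ← map_sub, QuotientAddGroup.mk'_apply, QuotientAddGroup.eq_zero_iff]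
        convert finsuppSMulHom_mem_vanishingFamilies (Finsupp.single m (r : R) -
          Finsupp.single (r • m) 1) (by simp [Int.cast_smul_eq_zsmul]) p using 1
        classical
        ext x
        simp only [Finsupp.sub_apply, Finsupp.single_apply, finsuppSMulHom_apply,
          MulOpposite.op_sub, sub_smul, apply_ite MulOpposite.op]
        congr 1
        · split_ifs
          · simp [Int.cast_smul_eq_zsmul]
          · simp
        · split_ifs <;> simp))
    (by
      refine (AddSubgroup.closure_le _).2 ?_
      rintro _ ⟨p, r, m, rfl⟩
      rw [SetLike.mem_coe, AddMonoidHom.mem_ker, map_sub]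
      simp only [TensorProduct.liftAddHom_tmul, AddMonoidHom.mk'_apply]
      rw [← map_sub, QuotientAddGroup.mk'_apply, QuotientAddGroup.eq_zero_iff]
      convert finsuppSMulHom_mem_vanishingFamilies (Finsupp.single m r -
        Finsupp.single (r • m) 1) (by simp) p using 1
      classical
      ext x
      simp only [Finsupp.sub_apply, Finsupp.single_apply, finsuppSMulHom_apply,
        MulOpposite.op_sub, sub_smul, apply_ite MulOpposite.op]
      congr 1 <;> split_ifs <;> simp)

/-- If `∑ pₘ ⊗ m = 0` in `P ⊗_R M`, then there are finitely many relations `∑ₘ kₘ m = 0`, and for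
each of them an element `qₖ` of `P`, with `pₘ = ∑ₖ qₖ kₘ`. -/
theorem exists_of_sum_tmulHom_eq_zero (x : M →₀ P)
    (hx : (x.sum fun m p => BalancedTensor.tmulHom R P m p) = 0) :
    ∃ (s : Finset (M →₀ R)) (q : (M →₀ R) → P),
      (∀ k ∈ s, Finsupp.linearCombination R (id : M → M) k = 0) ∧
      ∀ m, x m = ∑ k ∈ s, MulOpposite.op (k m) • q k := by
  classical
  have hmem : x ∈ vanishingFamilies R P M := by
    rw [← QuotientAddGroup.eq_zero_iff, ← QuotientAddGroup.mk'_apply]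
    have := congrArg (toFamilies R P M) hx
    rw [map_zero, Finsupp.sum, map_sum] at this
    rw [← this]
    conv_lhs => rw [← Finsupp.sum_single x, Finsupp.sum, map_sum]
    rfl
  obtain ⟨t, rfl⟩ := hmem
  refine ⟨t.support.image Subtype.val, fun k => if hk : _ then t ⟨k, hk⟩ else 0, ?_, fun m => ?_⟩
  · intro k hk
    obtain ⟨k, -, rfl⟩ := Finset.mem_image.1 hk
    exact k.2
  · rw [Finset.sum_image fun _ _ _ _ h => Subtype.ext h, Finsupp.liftAddHom_apply, Finsupp.sum,
      Finsupp.finsetSum_apply]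
    refine Finset.sum_congr rfl fun k _ => ?_
    beta_reduce
    rw [finsuppSMulHom_apply, dif_pos k.2]

end Vanishing

/-! ### Flatness and the equational criterion -/

section FlatCriterion

variable {R : Type u} [Ring R] {M : Type v} [AddCommGroup M] [Module R M]

open BalancedTensor in
theorem IsFlatModule.of_relationsTrivial (h : RelationsTrivial R M) : IsFlatModule R M := by
  classical
  intro P Q _ _ _ _ f hf
  refine (injective_iff_map_eq_zero _).2 fun z hz => ?_
  obtain ⟨x, rfl⟩ := exists_finsupp z
  obtain ⟨s, q, hs, hq⟩ := exists_of_sum_tmulHom_eq_zero (P := Q)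
    (x.mapRange f (map_zero f)) (by
      rw [Finsupp.sum_mapRange_index fun _ => map_zero _, ← hz, Finsupp.sum, Finsupp.sum, map_sum]
      rfl)
  -- A finite set of elements of `M` that carries `x` and all the relations involved.
  let N : Finset M := x.support ∪ s.biUnion fun k => k.support
  have hN : ∀ k ∈ s, ∑ m : N, k m • (m : M) = 0 := by
    intro k hk
    rw [← hs k hk, Finsupp.linearCombination_apply, Finsupp.sum_of_support_subset k
      (Finset.subset_union_right.trans' (Finset.subset_biUnion_of_mem (fun k => k.support) hk))
      (fun m r => r • id m) (by simp)]
    exact Finset.sum_coe_sort N fun m => k m • m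
  obtain ⟨l, b, n, h₁, h₂⟩ := h.exists_of_finset s (fun k (m : N) => k m) (fun m => m) hN
  have hz0 : ∀ j, ∑ m : N, MulOpposite.op (b m j) • x m = 0 := by
    intro j
    apply hf
    rw [map_zero, map_sum]
    have : ∀ m, f (x m) = ∑ k ∈ s, MulOpposite.op (k m) • q k := hq
    simp_rw [map_smul, this, Finset.smul_sum, smul_smul, ← MulOpposite.op_mul]
    rw [Finset.sum_comm]
    refine Finset.sum_eq_zero fun k hk => ?_
    rw [← Finset.sum_smul, ← Finset.op_sum, h₂ k hk j, MulOpposite.op_zero, zero_smul]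
  rw [Finsupp.sum_of_support_subset x (s := N) Finset.subset_union_left _ (by simp),
    ← Finset.sum_coe_sort N fun m => tmulHom R P m (x m)]
  have : ∀ (m : N) (p : P), tmulHom R P (m : M) p =
      ∑ j, tmulHom R P (n j) (MulOpposite.op (b m j) • p) := by
    intro m p
    conv_lhs => rw [h₁ m, tmulHom_sum]
    simp_rw [tmulHom_smul]
  simp_rw [this]
  rw [Finset.sum_comm]
  simp_rw [← map_sum, hz0, map_zero, Finset.sum_const_zero]

open BalancedTensor in
/-- For a relation `∑ rᵢ mᵢ = 0`, the row `r` embeds `R ^ k / ker r` into `R` as right modules.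
The element `∑ εᵢ ⊗ mᵢ` dies in `R ⊗ M = M`, hence already in `(R ^ k / ker r) ⊗ M`, and
comparing coordinates in `R ^ k` expresses the `mᵢ` as required. -/
theorem IsFlatModule.relationsTrivial (h : IsFlatModule R M) : RelationsTrivial R M := by
  classical
  refine RelationsTrivial.of_exists_fintype fun k r m hrm => ?_
  let ρ : (Fin k → R) →ₗ[Rᵐᵒᵖ] R :=
    { toFun := fun x => ∑ i, r i * x i
      map_add' := fun x y => by simp [mul_add, Finset.sum_add_distrib]
      map_smul' := fun a x => by simp [Finset.sum_mul, mul_assoc] }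
  let ε : Fin k → Fin k → R := fun i => Pi.single i 1
  let x : M →₀ (Fin k → R) ⧸ LinearMap.ker ρ :=
    ∑ i, Finsupp.single (m i) ((LinearMap.ker ρ).mkQ (ε i))
  have hinj : Function.Injective ((LinearMap.ker ρ).liftQ ρ le_rfl) :=
    LinearMap.ker_eq_bot.1 (Submodule.ker_liftQ_eq_bot _ _ _ le_rfl)
  have hx : (x.sum fun m p => tmulHom R _ m p) = 0 := by
    apply h _ _ _ hinj
    have hρ : ∀ i, ρ (ε i) = r i := fun i => by simp [ρ, ε, Pi.single_apply]
    rw [map_zero, Finsupp.sum, map_sum]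
    simp_rw [map_tmulHom]
    change (x.sum fun m p => tmulHom R R m ((LinearMap.ker ρ).liftQ ρ le_rfl p)) = 0
    rw [← Finsupp.sum_finsetSum_index (by simp) (by simp)]
    have : ∀ i, tmulHom R R (m i) (r i) = tmulHom R R (r i • m i) 1 := fun i => by
      rw [tmulHom_smul]; simp
    simp only [map_zero, Finsupp.sum_single_index, Submodule.mkQ_apply, Submodule.liftQ_apply,
      hρ, this]
    rw [← tmulHom_sum, hrm, tmulHom_zero]
  obtain ⟨s, q, hs, hq⟩ := exists_of_sum_tmulHom_eq_zero x hx
  choose q' hq' using fun k => (LinearMap.ker ρ).mkQ_surjective (q k)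
  let N : Finset M := Finset.univ.image m ∪ s.biUnion fun k => k.support
  let l : M → Fin k → R := fun y => (∑ i, if m i = y then ε i else 0) -
    ∑ k ∈ s, MulOpposite.op (k y) • q' k
  have hl : ∀ y, ρ (l y) = 0 := by
    intro y
    rw [← LinearMap.mem_ker, ← Submodule.Quotient.mk_eq_zero, ← Submodule.mkQ_apply, map_sub,
      map_sum, map_sum, sub_eq_zero]
    simp_rw [map_smul, hq']
    rw [← hq y, Finsupp.finsetSum_apply]
    refine Finset.sum_congr rfl fun i _ => ?_
    rw [Finsupp.single_apply]
    split_ifs <;> simp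
  refine ⟨Fin N.card, inferInstance, fun i j => l (N.equivFin.symm j) i,
    fun j => (N.equivFin.symm j : M), fun i => ?_, fun j => hl _⟩
  rw [N.equivFin.symm.sum_comp fun y : N => l y i • (y : M),
    Finset.sum_coe_sort N fun y => l y i • y]
  simp only [l, Pi.sub_apply, Finset.sum_apply, sub_smul, Finset.sum_sub_distrib, Finset.sum_smul,
    Pi.smul_apply, MulOpposite.smul_eq_mul_unop, MulOpposite.unop_op, mul_smul]
  have h₁ : ∑ y ∈ N, ∑ k ∈ s, q' k i • k y • y = 0 := by
    rw [Finset.sum_comm]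
    refine Finset.sum_eq_zero fun k hk => ?_
    have := hs k hk
    rw [Finsupp.linearCombination_apply, Finsupp.sum_of_support_subset k
      (Finset.subset_union_right.trans' (Finset.subset_biUnion_of_mem (fun k => k.support) hk))
      (fun m r => r • id m) (by simp)] at this
    rw [← Finset.smul_sum]
    simp only [id] at this
    rw [this, smul_zero]
  rw [h₁, sub_zero, Finset.sum_comm, Finset.sum_eq_single i]
  · rw [Finset.sum_eq_single (m i)]
    · simp [ε]
    · intro y _ hy
      simp [hy.symm]
    · intro hi
      exact absurd (Finset.mem_union_left _ (Finset.mem_image_of_mem m (Finset.mem_univ i))) hi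
  · intro i' _ hi'
    refine Finset.sum_eq_zero fun y _ => ?_
    split_ifs
    · simp [ε, hi'.symm]
    · simp
  · simp

/-- Projective modules are flat: coordinates with respect to a section of a map from a free module
trivialize all relations. -/
theorem RelationsTrivial.of_projective [Module.Projective R M] : RelationsTrivial R M := by
  classical
  obtain ⟨σ, hσ⟩ := Module.projective_def'.1 (inferInstance : Module.Projective R M)
  refine RelationsTrivial.of_exists_fintype fun k r m hrm => ?_
  let N : Finset M := Finset.univ.biUnion fun i => (σ (m i)).support
  refine ⟨Fin N.card, inferInstance, fun i j => σ (m i) (N.equivFin.symm j),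
    fun j => (N.equivFin.symm j : M), fun i => ?_, fun j => ?_⟩
  · rw [N.equivFin.symm.sum_comp fun y : N => σ (m i) y • (y : M),
      Finset.sum_coe_sort N fun y => σ (m i) y • y]
    conv_lhs => rw [← LinearMap.id_apply (R := R) (m i), ← hσ, LinearMap.comp_apply,
      Finsupp.linearCombination_apply]
    exact Finsupp.sum_of_support_subset _
      (Finset.subset_biUnion_of_mem (fun i => (σ (m i)).support) (Finset.mem_univ i)) _ (by simp)
  · have := DFunLike.congr_fun (congrArg σ hrm) (N.equivFin.symm j : M)
    simpa using this

end FlatCriterion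

/-! ### Projective covers over semiprimary rings -/

section Nakayama

variable {S : Type*} [Ring S] {J : Ideal S} [J.IsTwoSided] {M : Type*} [AddCommGroup M] [Module S M]

theorem eq_top_of_sup_smul_eq_top_of_isNilpotent (hJ : IsNilpotent J) {N : Submodule S M}
    (h : N ⊔ J • (⊤ : Submodule S M) = ⊤) : N = ⊤ := by
  have key : ∀ k : ℕ, N ⊔ J ^ k • (⊤ : Submodule S M) = ⊤ := by
    intro k
    induction k with
    | zero => simp [Submodule.pow_zero, Ideal.one_eq_top]
    | succ k ih =>
      refine top_le_iff.1 ?_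
      conv_lhs => rw [← h]
      refine sup_le le_sup_left ?_
      conv_lhs => rw [← ih]
      rw [Submodule.smul_sup]
      refine sup_le (Submodule.smul_le_right.trans le_sup_left) ?_
      rw [← Submodule.mul_smul, ← Ideal.IsTwoSided.pow_succ]
      exact le_sup_right
  obtain ⟨n, hn⟩ := hJ
  simpa [hn] using key n

theorem eq_bot_of_le_smul_of_isNilpotent (hJ : IsNilpotent J) {N : Submodule S M}
    (h : N ≤ J • N) : N = ⊥ := by
  have key : ∀ k : ℕ, N ≤ J ^ k • N := by
    intro k
    induction k with
    | zero => simp [Submodule.pow_zero, Ideal.one_eq_top]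
    | succ k ih =>
      rw [Ideal.IsTwoSided.pow_succ, Submodule.mul_smul]
      exact h.trans (Submodule.smul_mono le_rfl ih)
  obtain ⟨n, hn⟩ := hJ
  simpa [hn] using key n

theorem isSmallSubmodule_of_le_smul_of_isNilpotent (hJ : IsNilpotent J) {K : Submodule S M}
    (h : K ≤ J • (⊤ : Submodule S M)) : IsSmallSubmodule K := fun N hN =>
  eq_top_of_sup_smul_eq_top_of_isNilpotent hJ <| top_le_iff.1 <| by
    rw [← hN, sup_comm K]
    exact sup_le_sup_left (h.trans (by rw [sup_comm, hN])) _

end Nakayama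

section Semiprimary

variable {S : Type*} [Ring S]

theorem exists_fintype_sum_of_mem_smul_top {J : Ideal S} {M : Type*} [AddCommGroup M]
    [Module S M] {x : M} (hx : x ∈ J • (⊤ : Submodule S M)) :
    ∃ (ι : Type) (_ : Fintype ι) (r : ι → S) (y : ι → M), (∀ i, r i ∈ J) ∧ x = ∑ i, r i • y i := by
  refine Submodule.smul_induction_on hx (fun r hr y _ => ?_) fun x y hx hy => ?_
  · exact ⟨Unit, inferInstance, fun _ => r, fun _ => y, fun _ => hr, by simp⟩
  · obtain ⟨ι, _, r, a, hr, rfl⟩ := hx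
    obtain ⟨κ, _, s, b, hs, rfl⟩ := hy
    exact ⟨ι ⊕ κ, inferInstance, Sum.elim r s, Sum.elim a b, Sum.rec hr hs, by simp⟩

/-- Reduction of endomorphisms of `M` modulo `J M`. -/
def endReduction (J : Ideal S) (M : Type*) [AddCommGroup M] [Module S M] :
    Module.End S M →+* Module.End S (M ⧸ J • (⊤ : Submodule S M)) where
  toFun φ := Submodule.mapQ _ _ φ (Submodule.map_le_iff_le_comap.1 (by
    rw [Submodule.map_smul'']; exact Submodule.smul_mono le_rfl le_top))
  map_one' := by ext; simp
  map_mul' φ ψ := by ext; simp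
  map_zero' := by ext; simp
  map_add' φ ψ := by ext; simp

theorem endReduction_mk (J : Ideal S) {M : Type*} [AddCommGroup M] [Module S M]
    (φ : Module.End S M) (x : M) :
    endReduction J M φ ((J • (⊤ : Submodule S M)).mkQ x) = (J • (⊤ : Submodule S M)).mkQ (φ x) :=
  rfl

theorem isNilpotent_of_mem_ker_endReduction {J : Ideal S} [J.IsTwoSided] (hJ : IsNilpotent J)
    {M : Type*} [AddCommGroup M] [Module S M] {φ : Module.End S M} (hφ : φ ∈ RingHom.ker (endReduction J M)) :
    IsNilpotent φ := by
  have h₁ : LinearMap.range φ ≤ J • ⊤ := by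
    rintro _ ⟨x, rfl⟩
    rw [← Submodule.Quotient.mk_eq_zero, ← Submodule.mkQ_apply, ← endReduction_mk,
      (RingHom.mem_ker).1 hφ, LinearMap.zero_apply]
  have key : ∀ k : ℕ, LinearMap.range (φ ^ k) ≤ J ^ k • ⊤ := by
    intro k
    induction k with
    | zero => simp [Submodule.pow_zero, Ideal.one_eq_top]
    | succ k ih =>
      rw [_root_.pow_succ, Module.End.mul_eq_comp, LinearMap.range_comp]
      refine (Submodule.map_mono h₁).trans ?_
      rw [Submodule.map_smul'', Submodule.map_top, Ideal.IsTwoSided.pow_succ, Submodule.mul_smul]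
      exact Submodule.smul_mono le_rfl ih
  obtain ⟨n, hn⟩ := hJ
  refine ⟨n, LinearMap.range_eq_bot.1 (le_bot_iff.1 ?_)⟩
  simpa [hn] using key n

theorem isSemisimpleModule_quotient_jacobson_smul_top [IsSemiprimaryRing S] (M : Type*)
    [AddCommGroup M] [Module S M] :
    IsSemisimpleModule S (M ⧸ Ring.jacobson S • (⊤ : Submodule S M)) := by
  have h : Module.IsTorsionBySet S (M ⧸ Ring.jacobson S • (⊤ : Submodule S M))
      (Ring.jacobson S) := by
    rw [Module.isTorsionBySet_quotient_iff]
    exact fun m i hi => Submodule.smul_mem_smul hi trivial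
  let _ := h.module
  exact (h.semilinearMap.isSemisimpleModule_iff_of_bijective Function.bijective_id).2
    inferInstance

/-- A submodule `K` of a projective module `L` is cut off, up to `J L`, by an idempotent
endomorphism `ε` with image complementary to `K` modulo `J L`: the semisimple module `L / J L` has
such an endomorphism, and it lifts because the reduction of endomorphisms has nil kernel. -/
theorem exists_isIdempotentElem_end [IsSemiprimaryRing S] {L : Type*} [AddCommGroup L] [Module S L]
    [Module.Projective S L] (K : Submodule S L) :
    ∃ ε : Module.End S L, IsIdempotentElem ε ∧
      (∀ x, ∃ k ∈ K, x - ε x - k ∈ Ring.jacobson S • (⊤ : Submodule S L)) ∧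
      ∀ k ∈ K, ε k ∈ Ring.jacobson S • (⊤ : Submodule S L) := by
  have hss := isSemisimpleModule_quotient_jacobson_smul_top (S := S) L
  have hJ : IsNilpotent (Ring.jacobson S) := IsSemiprimaryRing.isNilpotent
  let q := (Ring.jacobson S • (⊤ : Submodule S L)).mkQ
  have hq₀ : ∀ x, q x = 0 ↔ x ∈ Ring.jacobson S • (⊤ : Submodule S L) :=
    fun x => Submodule.Quotient.mk_eq_zero _
  obtain ⟨N, hN⟩ := exists_isCompl (K.map q)
  obtain ⟨ε₀, hε₀, hker⟩ : ∃ ε₀ : Module.End S (L ⧸ Ring.jacobson S • (⊤ : Submodule S L)),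
      IsIdempotentElem ε₀ ∧ LinearMap.ker ε₀ = K.map q :=
    ⟨N.projection _ hN.symm, Submodule.isIdempotentElem_projection _, Submodule.ker_projection _⟩
  obtain ⟨φ, hφ⟩ := Module.projective_lifting_property q (ε₀ ∘ₗ q) (Submodule.mkQ_surjective _)
  have hφ' : endReduction (Ring.jacobson S) L φ = ε₀ :=
    Submodule.linearMap_qext _ hφ
  obtain ⟨ε, hε, hεε₀⟩ := exists_isIdempotentElem_eq_of_ker_isNilpotent
    (endReduction (Ring.jacobson S) L) (fun ψ hψ => isNilpotent_of_mem_ker_endReduction hJ hψ) ε₀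
    ⟨φ, hφ'⟩ hε₀
  have hq : ∀ x, q (ε x) = ε₀ (q x) := fun x => by rw [← hεε₀]; rfl
  refine ⟨ε, hε, fun x => ?_, fun k hk => ?_⟩
  · have h₁ : q (x - ε x) ∈ LinearMap.ker ε₀ := by
      rw [LinearMap.mem_ker, ← hq, map_sub, ← Module.End.mul_apply, hε.eq, sub_self, map_zero]
    rw [hker] at h₁
    obtain ⟨k, hk, hkx⟩ := h₁
    exact ⟨k, hk, by rw [← hq₀, map_sub, hkx, sub_self]⟩
  · rw [← hq₀, hq, ← LinearMap.mem_ker, hker]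
    exact Submodule.mem_map_of_mem hk

/-- Over a semiprimary ring with radical `J`, every module `M` is the image of a projective module
`P` with kernel contained in `J P`. -/
theorem exists_projective_ker_le_jacobson_smul {S : Type u} [Ring S] [IsSemiprimaryRing S]
    (M : Type (max u w)) [AddCommGroup M] [Module S M] :
    ∃ (P : Type (max u w)) (_ : AddCommGroup P) (_ : Module S P) (f : P →ₗ[S] M),
      Module.Projective S P ∧ Function.Surjective f ∧
        LinearMap.ker f ≤ Ring.jacobson S • (⊤ : Submodule S P) := by
  have hJ : IsNilpotent (Ring.jacobson S) := IsSemiprimaryRing.isNilpotent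
  let p : (M →₀ S) →ₗ[S] M := Finsupp.linearCombination S id
  obtain ⟨ε, hε, hε₁, hε₂⟩ := exists_isIdempotentElem_end (LinearMap.ker p)
  have hεε : ∀ x, ε (ε x) = ε x := fun x => LinearMap.congr_fun hε.eq x
  have hεr : ∀ y : LinearMap.range ε, ε.rangeRestrict y = y := by
    rintro ⟨_, x, rfl⟩
    exact Subtype.ext (hεε x)
  refine ⟨LinearMap.range ε, inferInstance, inferInstance, p ∘ₗ (LinearMap.range ε).subtype,
    Module.Projective.of_split (LinearMap.range ε).subtype ε.rangeRestrict (LinearMap.ext hεr),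
    ?_, ?_⟩
  · rw [← LinearMap.range_eq_top]
    refine eq_top_of_sup_smul_eq_top_of_isNilpotent hJ (top_le_iff.1 fun m _ => ?_)
    obtain ⟨k, hk, h₂⟩ := hε₁ (Finsupp.single m 1)
    have hx : p (Finsupp.single m 1) = m := by simp [p]
    have h₃ : p (Finsupp.single m 1 - ε (Finsupp.single m 1) - k) ∈
        Ring.jacobson S • (⊤ : Submodule S M) := by
      have := Submodule.mem_map_of_mem (f := p) h₂
      rw [Submodule.map_smul''] at this
      exact Submodule.smul_mono le_rfl le_top this
    have h₄ : m = p (ε (Finsupp.single m 1)) +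
        p (Finsupp.single m 1 - ε (Finsupp.single m 1) - k) := by
      rw [map_sub, map_sub, LinearMap.mem_ker.1 hk, hx]; abel
    rw [h₄]
    exact Submodule.add_mem_sup ⟨⟨ε (Finsupp.single m 1), _, rfl⟩, rfl⟩ h₃
  · intro y hy
    have h₂ := hε₂ y hy
    have h₃ := Submodule.mem_map_of_mem (f := ε.rangeRestrict) h₂
    have h₄ : ε y = y := congrArg Subtype.val (hεr y)
    rw [Submodule.map_smul'', h₄, hεr] at h₃
    exact Submodule.smul_mono le_rfl le_top h₃

/-- Flat modules over a semiprimary ring with radical `J` are projective: if `C = P / K` is flat,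
`P` is projective and `K ≤ J P`, then `K = J K` by the equational criterion, and `J` is
nilpotent. -/
theorem RelationsTrivial.projective {S : Type u} [Ring S] [IsSemiprimaryRing S]
    {C : Type (max u w)} [AddCommGroup C] [Module S C] (h : RelationsTrivial S C) :
    Module.Projective S C := by
  obtain ⟨P, _, _, f, hP, hf, hker⟩ := exists_projective_ker_le_jacobson_smul.{u, w} (S := S) C
  have hK : LinearMap.ker f ≤ Ring.jacobson S • LinearMap.ker f := by
    intro k hk
    obtain ⟨ι, _, r, y, hr, rfl⟩ := exists_fintype_sum_of_mem_smul_top (hker hk)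
    rw [LinearMap.mem_ker, map_sum] at hk
    simp_rw [map_smul] at hk
    obtain ⟨l, b, n, h₁, h₂⟩ := h.exists_of_fintype r (fun i => f (y i)) hk
    choose z hz using fun j => hf (n j)
    have h₃ : ∑ i, r i • y i = ∑ i, r i • (y i - ∑ j, b i j • z j) := by
      simp_rw [smul_sub, Finset.sum_sub_distrib, Finset.smul_sum, smul_smul]
      rw [Finset.sum_comm (f := fun i j => (r i * b i j) • z j)]
      simp_rw [← Finset.sum_smul, h₂]
      simp
    rw [h₃]
    refine Submodule.sum_mem _ fun i _ => Submodule.smul_mem_smul (hr i) ?_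
    rw [LinearMap.mem_ker, map_sub, map_sum]
    simp_rw [map_smul, hz, ← h₁ i, sub_self]
  have hinj := LinearMap.ker_eq_bot.1
    (eq_bot_of_le_smul_of_isNilpotent IsSemiprimaryRing.isNilpotent hK)
  exact Module.Projective.of_equiv (LinearEquiv.ofBijective f ⟨hinj, hf⟩)

end Semiprimary

/-! ### Flat covers with small kernel -/

/-- Every left `S`-module has a flat cover that is also a G-flat cover. -/
def HasSmallFlatCovers (S : Type u) [Ring S] : Prop :=
  ∀ (M : Type (max u w)) [AddCommGroup M] [Module S M],
    ∃ (C : Type (max u w)) (_ : AddCommGroup C) (_ : Module S C) (f : C →ₗ[S] M),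
      IsGFlatCover f ∧ IsFlatCover f

theorem HasSmallFlatCovers.isLeftGPerfect {S : Type u} [Ring S]
    (h : HasSmallFlatCovers.{u, w} S) : IsLeftGPerfect.{u, w} S := fun M _ _ =>
  let ⟨C, i, j, f, hf, _⟩ := h M
  ⟨C, i, j, f, hf⟩

/-- Flat covers of a module are unique up to isomorphism, so all of them have small kernel as soon
as one does. -/
theorem HasSmallFlatCovers.leftFlatCoversAreGFlatCovers {S : Type u} [Ring S]
    (h : HasSmallFlatCovers.{u, w} S) : LeftFlatCoversAreGFlatCovers.{u, w} S := by
  intro M _ _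
  obtain ⟨C, _, _, f, hG, hf⟩ := h M
  refine ⟨⟨C, _, _, f, hf⟩, fun D _ _ g hg => ?_⟩
  obtain ⟨a, ha⟩ := hg.precover C hf.flat f
  obtain ⟨b, hb⟩ := hf.precover D hg.flat g
  have hba := hf.minimal (b ∘ₗ a) (by rw [← LinearMap.comp_assoc, hb, ha])
  have hab := hg.minimal (a ∘ₗ b) (by rw [← LinearMap.comp_assoc, ha, hb])
  have hb_surj : Function.Surjective b := Function.Surjective.of_comp (g := a) hba.2
  have hb_inj : Function.Injective b := Function.Injective.of_comp (f := a) hab.1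
  refine ⟨hg.flat, fun m => ?_, fun N hN => ?_⟩
  · obtain ⟨c, rfl⟩ := hG.surjective m
    exact ⟨a c, LinearMap.congr_fun ha c⟩
  · have h₁ : N.map b = ⊤ := by
      refine hG.small_ker _ (top_le_iff.1 ?_)
      rw [← LinearMap.range_eq_top.2 hb_surj, ← Submodule.map_top, ← hN, Submodule.map_sup]
      refine sup_le_sup_right (Submodule.map_le_iff_le_comap.2 fun x hx => ?_) _
      exact (LinearMap.congr_fun hb x).trans hx
    exact Submodule.map_injective_of_injective hb_inj
      (h₁.trans (by rw [Submodule.map_top, LinearMap.range_eq_top.2 hb_surj]))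

theorem hasSmallFlatCovers_of_isSemiprimaryRing (S : Type u) [Ring S] [IsSemiprimaryRing S] :
    HasSmallFlatCovers.{u, w} S := by
  intro M _ _
  obtain ⟨P, _, _, f, hP, hf, hker⟩ := exists_projective_ker_le_jacobson_smul.{u, w} (S := S) M
  have hflat : IsFlatModule S P := IsFlatModule.of_relationsTrivial .of_projective
  have hsmall : IsSmallSubmodule (LinearMap.ker f) :=
    isSmallSubmodule_of_le_smul_of_isNilpotent IsSemiprimaryRing.isNilpotent hker
  refine ⟨P, _, _, f, ⟨hflat, hf, hsmall⟩, hflat, fun C _ _ hC g => ?_, fun g hg => ?_⟩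
  · have := RelationsTrivial.projective.{u, w} hC.relationsTrivial
    exact Module.projective_lifting_property f g hf
  · have hfg : ∀ x, f (g x) = f x := LinearMap.congr_fun hg
    have hsurj : Function.Surjective g := by
      rw [← LinearMap.range_eq_top]
      refine hsmall _ (top_le_iff.1 fun x _ => ?_)
      rw [← sub_add_cancel x (g x)]
      exact Submodule.add_mem_sup (by simp [hfg]) ⟨x, rfl⟩
    -- `g` splits, and its kernel has the range of the splitting as a complement; since the kernel
    -- lies in the small kernel of `f`, this complement is everything.
    obtain ⟨σ, hσ⟩ := Module.projective_lifting_property g LinearMap.id hsurj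
    have hgσ : ∀ x, g (σ x) = x := LinearMap.congr_fun hσ
    have hrange : LinearMap.range σ = ⊤ := by
      refine hsmall _ (top_le_iff.1 fun x _ => ?_)
      rw [← sub_add_cancel x (σ (g x))]
      refine Submodule.add_mem_sup ?_ ⟨g x, rfl⟩
      rw [LinearMap.mem_ker, ← hfg, map_sub, hgσ, sub_self, map_zero]
    refine ⟨fun x y hxy => ?_, hsurj⟩
    obtain ⟨a, rfl⟩ := LinearMap.range_eq_top.1 hrange x
    obtain ⟨b, rfl⟩ := LinearMap.range_eq_top.1 hrange y
    rw [hgσ, hgσ] at hxy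
    rw [hxy]

/-! ### Ring extensions by an ideal of regular corners -/

section RegularKernel

variable {R S : Type*} [Ring R] [Ring S]

/-- A central idempotent of `R` that lies in the kernel of `π`. -/
structure IsKerUnit (π : R →+* S) (e : R) : Prop where
  map_eq_zero : π e = 0
  mul_self : e * e = e
  comm : ∀ x, e * x = x * e

/-- A surjective ring homomorphism whose kernel is a von Neumann regular ideal and is the union of
the ideals `e R`, for central idempotents `e` in it. -/
structure HasRegularKernel (π : R →+* S) : Prop where
  surjective : Function.Surjective π
  exists_isKerUnit : ∀ x, π x = 0 → ∃ e, IsKerUnit π e ∧ e * x = x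
  regular : ∀ x, π x = 0 → ∃ y, x * y * x = x

variable {π : R →+* S}

theorem IsKerUnit.zero : IsKerUnit π 0 := ⟨map_zero π, by simp, by simp⟩

theorem IsKerUnit.exists_sup {e e' : R} (he : IsKerUnit π e) (he' : IsKerUnit π e') :
    ∃ e'', IsKerUnit π e'' ∧ e'' * e = e ∧ e'' * e' = e' := by
  have h₁ : (e + e' - e * e') * e = e := by
    rw [sub_mul, add_mul, he.mul_self, mul_assoc, he'.comm e, ← mul_assoc, he.mul_self]; abel
  have h₂ : (e + e' - e * e') * e' = e' := by
    rw [sub_mul, add_mul, he'.mul_self, mul_assoc, he'.mul_self]; abel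
  refine ⟨e + e' - e * e', ⟨?_, ?_, fun x => ?_⟩, h₁, h₂⟩
  · simp [he.map_eq_zero, he'.map_eq_zero]
  · rw [mul_sub, mul_add, h₁, h₂, ← mul_assoc, h₁]
  · rw [sub_mul, add_mul, mul_sub, mul_add, mul_assoc e e' x, he'.comm x, ← mul_assoc, he.comm x,
      mul_assoc x e e']

section Module

variable {M : Type*} [AddCommGroup M] [Module R M]

theorem IsKerUnit.exists_common (s : Finset M) (hs : ∀ m ∈ s, ∃ e, IsKerUnit π e ∧ e • m = m) :
    ∃ e, IsKerUnit π e ∧ ∀ m ∈ s, e • m = m := by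
  classical
  induction s using Finset.induction_on with
  | empty => exact ⟨0, .zero, by simp⟩
  | insert a s _ ih =>
    obtain ⟨e, he, hes⟩ := ih fun m hm => hs m (Finset.mem_insert_of_mem hm)
    obtain ⟨e', he', hea⟩ := hs a (Finset.mem_insert_self a s)
    obtain ⟨e'', he'', h₁, h₂⟩ := he.exists_sup he'
    refine ⟨e'', he'', fun m hm => ?_⟩
    rcases Finset.mem_insert.1 hm with rfl | hm
    · rw [← hea, smul_smul, h₂]
    · rw [← hes m hm, smul_smul, h₁]

/-- The union of the submodules `e M` of `M`, for the central idempotents `e ∈ ker π`. It is `I M`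
if the kernel `I` of `π` is the union of the ideals `e R`. -/
def kerPart (π : R →+* S) (M : Type*) [AddCommGroup M] [Module R M] : Submodule R M where
  carrier := {m | ∃ e, IsKerUnit π e ∧ e • m = m}
  zero_mem' := ⟨0, .zero, smul_zero _⟩
  add_mem' := by
    rintro a b ⟨e, he, hea⟩ ⟨e', he', heb⟩
    obtain ⟨e'', he'', h₁, h₂⟩ := he.exists_sup he'
    refine ⟨e'', he'', ?_⟩
    rw [smul_add]
    conv_lhs => rw [← hea, ← heb, smul_smul, smul_smul, h₁, h₂, hea, heb]
  smul_mem' := by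
    rintro r m ⟨e, he, hem⟩
    exact ⟨e, he, by rw [smul_smul, he.comm, mul_smul, hem]⟩

variable {Q : Type*} [AddCommGroup Q] [Module S Q]

/-- The `π`-semilinear map `q` exhibits the `S`-module `Q` as `M / I M`, where `I = ker π`. -/
structure IsReduction (q : M →ₛₗ[π] Q) : Prop where
  surjective : Function.Surjective q
  exists_isKerUnit : ∀ m, q m = 0 → ∃ e, IsKerUnit π e ∧ e • m = m

theorem HasRegularKernel.exists_isReduction (h : HasRegularKernel π) (M : Type v)
    [AddCommGroup M] [Module R M] :
    ∃ (Q : Type v) (_ : AddCommGroup Q) (_ : Module S Q) (q : M →ₛₗ[π] Q), IsReduction q := by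
  let θ : S →+* AddMonoid.End (M ⧸ kerPart π M) :=
    π.liftOfRightInverse (Function.surjInv h.surjective) (Function.rightInverse_surjInv _)
      ⟨Module.toAddMonoidEnd R (M ⧸ kerPart π M), fun x hx => by
        rw [RingHom.mem_ker]
        ext y
        obtain ⟨m, rfl⟩ := (kerPart π M).mkQ_surjective y
        obtain ⟨e, he, hex⟩ := h.exists_isKerUnit x hx
        change x • (kerPart π M).mkQ m = 0
        rw [← map_smul, Submodule.mkQ_apply, Submodule.Quotient.mk_eq_zero]
        exact ⟨e, he, by rw [smul_smul, hex]⟩⟩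
  have hθ : ∀ r, θ (π r) = Module.toAddMonoidEnd R _ r := fun r =>
    RingHom.liftOfRightInverse_comp_apply _ _ _ _ r
  refine ⟨M ⧸ kerPart π M, inferInstance, Module.compHom _ θ, ?_⟩
  let _ := Module.compHom (M ⧸ kerPart π M) θ
  refine ⟨{ toFun := (kerPart π M).mkQ, map_add' := map_add _, map_smul' := fun r m => ?_ },
    (kerPart π M).mkQ_surjective, fun m hm => (Submodule.Quotient.mk_eq_zero _).1 hm⟩
  change _ = θ (π r) _
  rw [hθ, map_smul]
  rfl

/-- A semilinear map out of `M` factors through the reduction `M / I M`. -/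
theorem IsReduction.exists_lift {q : M →ₛₗ[π] Q} (hq : IsReduction q)
    (hπ : Function.Surjective π) {P : Type*} [AddCommGroup P] [Module S P] (f : M →ₛₗ[π] P) :
    ∃ g : Q →ₗ[S] P, ∀ m, g (q m) = f m := by
  have hker : ∀ m, q m = 0 → f m = 0 := by
    intro m hm
    obtain ⟨e, he, hem⟩ := hq.exists_isKerUnit m hm
    rw [← hem, map_smulₛₗ, he.map_eq_zero, zero_smul]
  have hwd : ∀ m m', q m = q m' → f m = f m' := fun m m' hm =>
    sub_eq_zero.1 (by rw [← map_sub]; exact hker _ (by rw [map_sub, hm, sub_self]))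
  choose σ hσ using hq.surjective
  refine ⟨{ toFun := fun x => f (σ x), map_add' := fun x y => ?_, map_smul' := fun s x => ?_ },
    fun m => hwd _ _ (hσ _)⟩
  · rw [← map_add]
    exact hwd _ _ (by rw [map_add, hσ, hσ, hσ])
  · obtain ⟨r, rfl⟩ := hπ s
    rw [RingHom.id_apply, ← map_smulₛₗ]
    exact hwd _ _ (by rw [map_smulₛₗ, hσ, hσ])

end Module

/-- Finitely many elements of a von Neumann regular ideal have a common left unit in the right
ideal that they generate. -/
theorem exists_sum_mul_mul_eq (hreg : ∀ x, π x = 0 → ∃ y, x * y * x = x) {ι : Type*}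
    (s : Finset ι) (r : ι → R) (hr : ∀ i ∈ s, π (r i) = 0) :
    ∃ x : ι → R, ∀ j ∈ s, (∑ i ∈ s, r i * x i) * r j = r j := by
  classical
  induction s using Finset.induction_on with
  | empty => exact ⟨0, by simp⟩
  | insert a s ha ih =>
    obtain ⟨x, hx⟩ := ih fun i hi => hr i (Finset.mem_insert_of_mem hi)
    set g := ∑ i ∈ s, r i * x i with hg
    obtain ⟨y, hy⟩ := hreg (r a - g * r a) (by simp [hr a (Finset.mem_insert_self a s)])
    refine ⟨fun i => if i = a then y * (1 - g) else x i * (1 - r a * y * (1 - g)), ?_⟩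
    have hsum : ∑ i ∈ insert a s, r i *
        (if i = a then y * (1 - g) else x i * (1 - r a * y * (1 - g))) =
        g + (r a - g * r a) * y * (1 - g) := by
      rw [Finset.sum_insert ha, if_pos rfl, Finset.sum_congr rfl fun i hi => by
        rw [if_neg (ne_of_mem_of_not_mem hi ha), ← mul_assoc], ← Finset.sum_mul, ← hg]
      noncomm_ring
    intro j hj
    rw [hsum]
    rcases Finset.mem_insert.1 hj with rfl | hj
    · rw [add_mul, mul_assoc _ (1 - g), sub_mul 1, one_mul, hy]
      abel
    · rw [add_mul, mul_assoc _ (1 - g), sub_mul 1, one_mul, hx j hj, sub_self, mul_zero, add_zero]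

variable {M Q : Type*} [AddCommGroup M] [Module R M] [AddCommGroup Q] [Module S Q]

/-- If `M` is flat over `R`, then `M / I M` is flat over `S = R / I`. -/
theorem RelationsTrivial.reduction (hπ : HasRegularKernel π) {q : M →ₛₗ[π] Q} (hq : IsReduction q)
    (h : RelationsTrivial R M) : RelationsTrivial S Q := by
  intro k r m hrm
  choose r' hr' using fun i => hπ.surjective (r i)
  choose m' hm' using fun i => hq.surjective (m i)
  obtain ⟨e, he, hem⟩ := hq.exists_isKerUnit (∑ i, r' i • m' i) (by
    rw [← hrm, map_sum]
    simp_rw [map_smulₛₗ, hr', hm'])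
  obtain ⟨l, b, n, h₁, h₂⟩ := h k (fun i => (1 - e) * r' i) m' (by
    simp_rw [mul_smul]
    rw [← Finset.smul_sum, sub_smul, hem, one_smul, sub_self])
  refine ⟨l, fun i j => π (b i j), fun j => q (n j), fun i => ?_, fun j => ?_⟩
  · rw [← hm' i, h₁ i, map_sum]
    simp_rw [map_smulₛₗ]
  · have := congrArg π (h₂ j)
    simpa [he.map_eq_zero, hr'] using this

/-- If `M / I M` is flat over `S = R / I`, then `M` is flat over `R`. A relation is trivialized
modulo `I`. For a central idempotent `e ∈ I` that captures the error, this settles the part of the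
relation in `(1 - e) M`; the part in `e M` is trivial because the ring `e R` is von Neumann
regular. -/
theorem RelationsTrivial.of_reduction (hπ : HasRegularKernel π) {q : M →ₛₗ[π] Q}
    (hq : IsReduction q) (h : RelationsTrivial S Q) : RelationsTrivial R M := by
  classical
  refine RelationsTrivial.of_exists_fintype fun k r m hrm => ?_
  obtain ⟨l, b', n', h₁, h₂⟩ := h k (fun i => π (r i)) (fun i => q (m i)) (by
    rw [← map_zero q, ← hrm, map_sum]
    simp_rw [map_smulₛₗ])
  choose b hb using fun i j => hπ.surjective (b' i j)
  choose n hn using fun j => hq.surjective (n' j)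
  obtain ⟨e₁, he₁, hd⟩ := IsKerUnit.exists_common (π := π)
    (Finset.univ.image fun i => m i - ∑ j, b i j • n j) (by
      simp only [Finset.mem_image, Finset.mem_univ, true_and]
      rintro _ ⟨i, rfl⟩
      refine hq.exists_isKerUnit _ ?_
      rw [map_sub, map_sum, h₁ i, sub_eq_zero]
      simp_rw [map_smulₛₗ, hb, hn])
  obtain ⟨e₂, he₂, hc⟩ := IsKerUnit.exists_common (π := π)
    (Finset.univ.image fun j => ∑ i, r i * b i j) (by
      simp only [Finset.mem_image, Finset.mem_univ, true_and]
      rintro _ ⟨j, rfl⟩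
      refine hπ.exists_isKerUnit _ ?_
      rw [map_sum, ← h₂ j]
      simp_rw [map_mul, hb])
  obtain ⟨e, he, hee₁, hee₂⟩ := he₁.exists_sup he₂
  have hd' : ∀ i, e • (m i - ∑ j, b i j • n j) = m i - ∑ j, b i j • n j := by
    intro i
    rw [← hd _ (Finset.mem_image_of_mem _ (Finset.mem_univ i)), smul_smul, hee₁]
  have hc' : ∀ j, e * ∑ i, r i * b i j = ∑ i, r i * b i j := by
    intro j
    rw [← hc _ (Finset.mem_image_of_mem _ (Finset.mem_univ j)), smul_eq_mul, ← mul_assoc, hee₂]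
  obtain ⟨x, hx⟩ := exists_sum_mul_mul_eq hπ.regular Finset.univ (fun i => e * r i)
    (fun i _ => by simp [he.map_eq_zero])
  refine ⟨Fin l ⊕ Fin k, inferInstance,
    fun i => Sum.elim (fun j => (1 - e) * b i j)
      (fun j => (if i = j then e else 0) - x i * (e * r j)),
    Sum.elim n m, fun i => ?_, ?_⟩
  · have h₃ : ∑ j, ((if i = j then e else 0) - x i * (e * r j)) • m j = e • m i := by
      simp_rw [sub_smul, Finset.sum_sub_distrib, mul_smul, ← Finset.smul_sum, hrm]
      simp
    rw [Fintype.sum_sum_type]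
    simp only [Sum.elim_inl, Sum.elim_inr]
    rw [h₃]
    simp_rw [mul_smul]
    rw [← Finset.smul_sum]
    have := hd' i
    rw [smul_sub, sub_eq_sub_iff_add_eq_add] at this
    rw [sub_smul, one_smul, sub_add_eq_add_sub, eq_sub_iff_add_eq, add_comm, add_comm _ (e • m i),
      add_comm (e • ∑ j, b i j • n j), ← this]
  · rintro (j | j)
    · simp only [Sum.elim_inl]
      have : ∀ i, r i * ((1 - e) * b i j) = (1 - e) * (r i * b i j) := by
        intro i
        rw [← mul_assoc, ← mul_assoc, mul_sub, sub_mul 1, mul_one, one_mul, he.comm]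
      simp_rw [this]
      rw [← Finset.mul_sum, sub_mul, one_mul, hc', sub_self]
    · simp only [Sum.elim_inr, mul_sub, Finset.sum_sub_distrib]
      have h₃ : ∑ i, r i * (x i * (e * r j)) = e * r j := by
        refine Eq.trans ?_ (hx j (Finset.mem_univ j))
        rw [Finset.sum_mul]
        refine Finset.sum_congr rfl fun i _ => ?_
        rw [mul_assoc (e * r i), mul_assoc e, he.comm (r i * (x i * (e * r j))), mul_assoc (r i),
          mul_assoc (x i), mul_assoc e, ← he.comm (r j), ← mul_assoc e e, he.mul_self]
      rw [h₃]
      simp [he.comm]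

end RegularKernel

/-! ### Lifting covers along a ring extension -/

/-- Flat covers with small kernel lift along `π : R → S`: if `P → M / I M` is one over `S`, then
the pullback `M ×_{M / I M} P → M` is one over `R`. -/
theorem HasRegularKernel.hasSmallFlatCovers {R S : Type u} [Ring R] [Ring S] {π : R →+* S}
    (hπ : HasRegularKernel π) (hS : HasSmallFlatCovers.{u, w} S) :
    HasSmallFlatCovers.{u, w} R := by
  intro M _ _
  obtain ⟨Q, _, _, q, hq⟩ := hπ.exists_isReduction M
  obtain ⟨P, _, _, φ, hG, hF⟩ := hS Q
  let _ : Module R P := Module.compHom P π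
  let C : Submodule R (M × P) :=
    { carrier := {x | q x.1 = φ x.2}
      zero_mem' := by simp
      add_mem' := by
        intro x y hx hy
        change q (x.1 + y.1) = φ (x.2 + y.2)
        rw [map_add, map_add, hx, hy]
      smul_mem' := by
        intro r x hx
        change q (r • x.1) = φ (π r • x.2)
        rw [map_smulₛₗ, map_smul, hx] }
  let f : C →ₗ[R] M := LinearMap.fst R M P ∘ₗ C.subtype
  let p : C →ₛₗ[π] P :=
    { toFun := fun c => c.1.2
      map_add' := fun _ _ => rfl
      map_smul' := fun _ _ => rfl }
  have hC : ∀ c : C, q (f c) = φ (p c) := fun c => c.2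
  have hext : ∀ c d : C, f c = f d → p c = p d → c = d := fun c d h₁ h₂ =>
    Subtype.ext (Prod.ext h₁ h₂)
  have hp : IsReduction p := by
    refine ⟨fun y => ?_, fun c hc => ?_⟩
    · obtain ⟨m, hm⟩ := hq.surjective (φ y)
      exact ⟨⟨(m, y), hm⟩, rfl⟩
    · obtain ⟨e, he, hem⟩ := hq.exists_isKerUnit (f c) (by rw [hC, hc, map_zero])
      refine ⟨e, he, hext _ _ (by rw [map_smul, hem]) ?_⟩
      rw [map_smulₛₗ, hc, smul_zero]
  have hflat : IsFlatModule R C := IsFlatModule.of_relationsTrivial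
    (.of_reduction hπ hp hG.flat.relationsTrivial)
  have hsurj : Function.Surjective f := by
    intro m
    obtain ⟨y, hy⟩ := hG.surjective (q m)
    exact ⟨⟨(m, y), hy.symm⟩, rfl⟩
  refine ⟨C, inferInstance, inferInstance, f, ⟨hflat, hsurj, fun N hN => ?_⟩,
    hflat, fun C' _ _ hC' g => ?_, fun g hg => ?_⟩
  · have hdec : ∀ c : C, ∃ k : C, f k = 0 ∧ ∃ n ∈ N, k + n = c := fun c => by
      obtain ⟨k, hk, n, hn, hkn⟩ := Submodule.mem_sup.1 (hN ▸ Submodule.mem_top : c ∈ _ ⊔ N)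
      exact ⟨k, hk, n, hn, hkn⟩
    -- `I C` lies in `N`, since `e • k = 0` for `k` in the kernel of `f`.
    have hkerN : ∀ c, p c = 0 → c ∈ N := by
      intro c hc
      obtain ⟨e, he, hec⟩ := hp.exists_isKerUnit c hc
      obtain ⟨k, hk, n, hn, rfl⟩ := hdec c
      have hek : e • k = 0 := hext _ _ (by rw [map_smul, hk, smul_zero, map_zero])
        (by rw [map_smulₛₗ, he.map_eq_zero, zero_smul, map_zero])
      rw [← hec, smul_add, hek, zero_add]
      exact N.smul_mem e hn
    have : RingHomSurjective π := ⟨hπ.surjective⟩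
    have htop : N.map p = ⊤ := by
      refine hG.small_ker _ (top_le_iff.1 fun y _ => ?_)
      obtain ⟨c, rfl⟩ := hp.surjective y
      obtain ⟨k, hk, n, hn, rfl⟩ := hdec c
      rw [map_add]
      refine Submodule.add_mem_sup ?_ (Submodule.mem_map_of_mem hn)
      rw [LinearMap.mem_ker, ← hC, hk, map_zero]
    refine top_le_iff.1 fun c _ => ?_
    obtain ⟨n, hn, hnc⟩ : p c ∈ N.map p := htop ▸ Submodule.mem_top
    rw [← sub_add_cancel c n]
    exact N.add_mem (hkerN _ (by rw [map_sub, hnc, sub_self])) hn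
  · obtain ⟨Q', _, _, q', hq'⟩ := hπ.exists_isReduction C'
    obtain ⟨g₁, hg₁⟩ := hq'.exists_lift hπ.surjective (q.comp g)
    obtain ⟨h₁, hh₁⟩ := hF.precover Q'
      (IsFlatModule.of_relationsTrivial (hC'.relationsTrivial.reduction hπ hq')) g₁
    refine ⟨{ toFun := fun c => ⟨(g c, h₁ (q' c)), ?_⟩, map_add' := ?_, map_smul' := ?_ }, rfl⟩
    · exact (hg₁ c).symm.trans (LinearMap.congr_fun hh₁ (q' c)).symm
    · exact fun c d => hext _ _ (map_add g c d)
        ((congrArg h₁ (map_add q' c d)).trans (map_add h₁ _ _))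
    · exact fun r c => hext _ _ (map_smul g r c)
        ((congrArg h₁ (map_smulₛₗ q' r c)).trans (map_smul h₁ _ _))
  · obtain ⟨g₁, hg₁⟩ := hp.exists_lift hπ.surjective (p.comp g)
    replace hg₁ : ∀ c, g₁ (p c) = p (g c) := hg₁
    have hfg : ∀ c, f (g c) = f c := LinearMap.congr_fun hg
    have hbij := hF.minimal g₁ (by
      ext y
      obtain ⟨c, rfl⟩ := hp.surjective y
      rw [LinearMap.comp_apply, hg₁, ← hC, hfg, hC])
    constructor
    · refine (injective_iff_map_eq_zero g).2 fun c hc => hext _ _ ?_ (hbij.1 ?_)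
      · rw [← hfg, hc]
      · rw [hg₁, hc, map_zero, map_zero]
    · intro c
      obtain ⟨y, hy⟩ := hbij.2 (p c)
      obtain ⟨c', rfl⟩ := hp.surjective y
      have hd : p (c - g c') = 0 := by rw [map_sub, ← hg₁, hy, sub_self]
      refine ⟨c' + (c - g c'), ?_⟩
      -- `g` fixes the kernel of `p` elementwise.
      have : g (c - g c') = c - g c' := hext _ _ (hfg _) (by rw [← hg₁, hd, map_zero])
      rw [map_add, this]
      abel

/-! ### Regularity and the Jacobson radical -/

section Regular

theorem eq_zero_of_mem_jacobson_of_mul_mul_eq {R : Type*} [Ring R] {z w : R}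
    (hz : z ∈ Ring.jacobson R) (hzw : z * w * z = z) : z = 0 := by
  have hp : z * w ∈ Ring.jacobson R := Ideal.mul_mem_right _ _ hz
  rw [← Ideal.jacobson_bot, Ideal.mem_jacobson_iff] at hp
  obtain ⟨u, hu⟩ := hp (-1)
  rw [Ideal.mem_bot] at hu
  have h₁ : u * (z - z * w * z) = z := by
    have : u * -1 * (z * w) + u = 1 := sub_eq_zero.1 hu
    calc u * (z - z * w * z) = (u * -1 * (z * w) + u) * z := by noncomm_ring
      _ = z := by rw [this, one_mul]
  rwa [hzw, sub_self, mul_zero, eq_comm] at h₁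

theorem IsVonNeumannRegular.jacobson_eq_bot {R : Type u} [Ring R] (h : IsVonNeumannRegular R) :
    Ring.jacobson R = ⊥ :=
  (Submodule.eq_bot_iff _).2 fun x hx =>
    let ⟨_, hy⟩ := h x
    eq_zero_of_mem_jacobson_of_mul_mul_eq hx hy

theorem IsVonNeumannRegular.of_surjective {R : Type u} {S : Type v} [Ring R] [Ring S]
    (h : IsVonNeumannRegular R) (f : R →+* S) (hf : Function.Surjective f) :
    IsVonNeumannRegular S := by
  intro a
  obtain ⟨a, rfl⟩ := hf a
  obtain ⟨x, hx⟩ := h a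
  exact ⟨f x, by rw [← map_mul, ← map_mul, hx]⟩

theorem IsVonNeumannRegular.of_quotient_of_eq_bot {R : Type u} [Ring R] {I : Ideal R}
    [I.IsTwoSided] (h : IsVonNeumannRegular (R ⧸ I)) (hI : I = ⊥) : IsVonNeumannRegular R := by
  intro a
  obtain ⟨x, hx⟩ := h (Ideal.Quotient.mk I a)
  obtain ⟨x, rfl⟩ := Ideal.Quotient.mk_surjective x
  refine ⟨x, ?_⟩
  rwa [← map_mul, ← map_mul, Ideal.Quotient.eq, hI, Ideal.mem_bot, sub_eq_zero] at hx

theorem IsVonNeumannRegular.pi {ι : Type v} {T : Type u} [Ring T] (h : IsVonNeumannRegular T) :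
    IsVonNeumannRegular (ι → T) := fun a =>
  ⟨fun i => (h (a i)).choose, funext fun i => (h (a i)).choose_spec⟩

/-- Matrix rings over a field are von Neumann regular: every linear map `f` has a generalized
inverse, obtained by extending a section of the map from the domain of `f` onto its range. -/
theorem isVonNeumannRegular_matrix (F : Type u) [Field F] (n : ℕ) :
    IsVonNeumannRegular (Matrix (Fin n) (Fin n) F) := by
  intro a
  let f := Matrix.toLin' a
  obtain ⟨s, hs⟩ := f.rangeRestrict.exists_rightInverse_of_surjective f.range_rangeRestrict
  obtain ⟨g, hg⟩ := s.exists_extend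
  refine ⟨LinearMap.toMatrix' g, Matrix.toLin'.injective ?_⟩
  rw [Matrix.toLin'_mul, Matrix.toLin'_mul, Matrix.toLin'_toMatrix']
  refine LinearMap.ext fun v => ?_
  have h₁ : g (f v) = s (f.rangeRestrict v) := LinearMap.congr_fun hg (f.rangeRestrict v)
  have h₂ : f (s (f.rangeRestrict v)) = f v :=
    congrArg Subtype.val (LinearMap.congr_fun hs (f.rangeRestrict v))
  change f (g (f v)) = f v
  rw [h₁, h₂]

/-- If `R` is an extension by a regular ideal `I = ker π` with zero right annihilator, then
`R` is semiprimitive, as `I J(R)` is both regular and contained in the radical. -/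
theorem HasRegularKernel.jacobson_eq_bot {R S : Type*} [Ring R] [Ring S] {π : R →+* S}
    (hπ : HasRegularKernel π) (hann : ∀ x, (∀ y, π y = 0 → y * x = 0) → x = 0) :
    Ring.jacobson R = ⊥ := by
  refine (Submodule.eq_bot_iff _).2 fun x hx => hann x fun y hy => ?_
  obtain ⟨w, hw⟩ := hπ.regular (y * x) (by rw [map_mul, hy, zero_mul])
  exact eq_zero_of_mem_jacobson_of_mul_mul_eq (Ideal.mul_mem_left _ y hx) hw

theorem HasRegularKernel.op {R S : Type*} [Ring R] [Ring S] {π : R →+* S}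
    (hπ : HasRegularKernel π) : HasRegularKernel (RingHom.op π) where
  surjective s := by
    obtain ⟨r, hr⟩ := hπ.surjective s.unop
    exact ⟨MulOpposite.op r, MulOpposite.unop_injective hr⟩
  exists_isKerUnit x hx := by
    obtain ⟨e, he, hex⟩ := hπ.exists_isKerUnit x.unop (MulOpposite.op_injective hx)
    refine ⟨MulOpposite.op e, ⟨MulOpposite.unop_injective he.map_eq_zero,
      MulOpposite.unop_injective he.mul_self, fun y => MulOpposite.unop_injective ?_⟩,
      MulOpposite.unop_injective ?_⟩
    · exact (he.comm y.unop).symm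
    · exact (he.comm x.unop).symm.trans hex
  regular x hx := by
    obtain ⟨y, hy⟩ := hπ.regular x.unop (MulOpposite.op_injective hx)
    exact ⟨MulOpposite.op y, MulOpposite.unop_injective ((mul_assoc _ _ _).symm.trans hy)⟩

end Regular

/-! ### Rings of eventually constant sequences -/

section EventuallyConstant

variable {T : Type u} [Ring T] (A : Subring T)

theorem eventuallyConstant_value_unique {T : Type*} {a : ℕ → T} {x y : T}
    (hx : ∃ n, ∀ i, n ≤ i → a i = x) (hy : ∃ n, ∀ i, n ≤ i → a i = y) : x = y := by
  obtain ⟨n, hn⟩ := hx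
  obtain ⟨m, hm⟩ := hy
  rw [← hn (max n m) (le_max_left _ _), hm (max n m) (le_max_right _ _)]

/-- The ring homomorphism sending a sequence to its eventual value. -/
noncomputable def eventualValue : eventuallyConstant A →+* A where
  toFun a := ⟨a.2.choose, a.2.choose_spec.1⟩
  map_one' := Subtype.ext <| eventuallyConstant_value_unique
    (Exists.choose_spec (1 : eventuallyConstant A).2).2 ⟨0, fun _ _ => rfl⟩
  map_zero' := Subtype.ext <| eventuallyConstant_value_unique
    (Exists.choose_spec (0 : eventuallyConstant A).2).2 ⟨0, fun _ _ => rfl⟩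
  map_mul' a b := Subtype.ext <| by
    obtain ⟨n, hn⟩ := a.2.choose_spec.2
    obtain ⟨m, hm⟩ := b.2.choose_spec.2
    exact eventuallyConstant_value_unique (a * b).2.choose_spec.2 ⟨max n m, fun i hi =>
      congrArg₂ (· * ·) (hn i (le_of_max_le_left hi)) (hm i (le_of_max_le_right hi))⟩
  map_add' a b := Subtype.ext <| by
    obtain ⟨n, hn⟩ := a.2.choose_spec.2
    obtain ⟨m, hm⟩ := b.2.choose_spec.2
    exact eventuallyConstant_value_unique (a + b).2.choose_spec.2 ⟨max n m, fun i hi =>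
      congrArg₂ (· + ·) (hn i (le_of_max_le_left hi)) (hm i (le_of_max_le_right hi))⟩

variable {A}

theorem eventualValue_eq_iff {a : eventuallyConstant A} {x : A} :
    eventualValue A a = x ↔ ∃ n, ∀ i, n ≤ i → a.1 i = x := by
  refine ⟨?_, fun h => Subtype.ext (eventuallyConstant_value_unique a.2.choose_spec.2 h)⟩
  rintro rfl
  exact a.2.choose_spec.2

theorem hasRegularKernel_eventualValue (hT : IsVonNeumannRegular T) :
    HasRegularKernel (eventualValue A) where
  surjective x := ⟨⟨fun _ => x, x, x.2, 0, fun _ _ => rfl⟩,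
    eventualValue_eq_iff.2 ⟨0, fun _ _ => rfl⟩⟩
  exists_isKerUnit a ha := by
    obtain ⟨n, hn⟩ := eventualValue_eq_iff.1 ha
    have hz : ∀ i, n ≤ i → (if i < n then (1 : T) else 0) = 0 := fun i hi => if_neg hi.not_gt
    refine ⟨⟨fun i => if i < n then 1 else 0, 0, A.zero_mem, n, hz⟩,
      ⟨eventualValue_eq_iff.2 ⟨n, hz⟩, ?_, fun b => ?_⟩, ?_⟩
    · refine Subtype.ext (funext fun i => ?_)
      change (if i < n then (1 : T) else 0) * (if i < n then (1 : T) else 0) =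
        if i < n then 1 else 0
      split_ifs <;> simp
    · refine Subtype.ext (funext fun i => ?_)
      change (if i < n then (1 : T) else 0) * b.1 i = b.1 i * (if i < n then (1 : T) else 0)
      split_ifs <;> simp
    · refine Subtype.ext (funext fun i => ?_)
      change (if i < n then (1 : T) else 0) * a.1 i = a.1 i
      split_ifs with hi
      · rw [one_mul]
      · rw [zero_mul, hn i (not_lt.1 hi)]; rfl
  regular a ha := by
    obtain ⟨n, hn⟩ := eventualValue_eq_iff.1 ha
    choose y hy using hT
    refine ⟨⟨fun i => if i < n then y (a.1 i) else 0, 0, A.zero_mem, n,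
      fun i hi => if_neg hi.not_gt⟩, Subtype.ext (funext fun i => ?_)⟩
    change a.1 i * (if i < n then y (a.1 i) else 0) * a.1 i = a.1 i
    split_ifs with hi
    · exact hy _
    · rw [mul_zero, zero_mul, hn i (not_lt.1 hi)]; rfl

theorem jacobson_eventuallyConstant (hT : IsVonNeumannRegular T) :
    Ring.jacobson (eventuallyConstant A) = ⊥ := by
  refine (hasRegularKernel_eventualValue hT).jacobson_eq_bot fun a ha =>
    Subtype.ext (funext fun j => ?_)
  have hz : ∀ i, j + 1 ≤ i → (Pi.single j (1 : T) : ℕ → T) i = 0 := fun i hi =>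
    Pi.single_eq_of_ne (by omega) _
  have := congrFun (congrArg Subtype.val (ha ⟨Pi.single j 1, 0, A.zero_mem, j + 1, hz⟩
    (eventualValue_eq_iff.2 ⟨j + 1, hz⟩))) j
  change (Pi.single j (1 : T) : ℕ → T) j * a.1 j = 0 at this
  rwa [Pi.single_eq_same, one_mul] at this

theorem not_isVonNeumannRegular_eventuallyConstant (hT : IsVonNeumannRegular T)
    (hA : ¬ IsVonNeumannRegular A) : ¬ IsVonNeumannRegular (eventuallyConstant A) := fun h =>
  hA (h.of_surjective _ (hasRegularKernel_eventualValue hT).surjective)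

theorem hasSmallFlatCovers_eventuallyConstant (hT : IsVonNeumannRegular T)
    (hA : HasSmallFlatCovers.{u, w} A) : HasSmallFlatCovers.{u, w} (eventuallyConstant A) :=
  (hasRegularKernel_eventualValue hT).hasSmallFlatCovers hA

theorem hasSmallFlatCovers_op_eventuallyConstant (hT : IsVonNeumannRegular T)
    (hA : HasSmallFlatCovers.{u, w} Aᵐᵒᵖ) :
    HasSmallFlatCovers.{u, w} (eventuallyConstant A)ᵐᵒᵖ :=
  (hasRegularKernel_eventualValue hT).op.hasSmallFlatCovers hA

theorem isGPerfectCounterexample_eventuallyConstant (hT : IsVonNeumannRegular T)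
    (hA : ¬ IsVonNeumannRegular A) (hl : HasSmallFlatCovers.{u, w} A)
    (hr : HasSmallFlatCovers.{u, w} Aᵐᵒᵖ) :
    IsGPerfectCounterexample.{u, w} (eventuallyConstant A) where
  leftGPerfect := (hasSmallFlatCovers_eventuallyConstant hT hl).isLeftGPerfect
  rightGPerfect := (hasSmallFlatCovers_op_eventuallyConstant hT hr).isLeftGPerfect
  semiprimitive := jacobson_eventuallyConstant hT
  not_regular := not_isVonNeumannRegular_eventuallyConstant hT hA
  not_regular_mod_jacobson h := by
    exact not_isVonNeumannRegular_eventuallyConstant hT hA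
      (h.of_quotient_of_eq_bot (jacobson_eventuallyConstant hT))
  left_flatCovers := (hasSmallFlatCovers_eventuallyConstant hT hl).leftFlatCoversAreGFlatCovers
  right_flatCovers :=
    (hasSmallFlatCovers_op_eventuallyConstant hT hr).leftFlatCoversAreGFlatCovers

end EventuallyConstant

/-! ### Subalgebras of matrix algebras -/

theorem isGPerfectCounterexample_of_subalgebra {F : Type u} [Field F] {n : ℕ}
    (A : Subalgebra F (Matrix (Fin n) (Fin n) F)) (hA : ¬ IsVonNeumannRegular A) :
    IsGPerfectCounterexample.{u, w} (eventuallyConstant A.toSubring) ∧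
      IsGPerfectCounterexample.{u, w} (eventuallyConstant (eventuallyConstant A.toSubring)) := by
  have hT := isVonNeumannRegular_matrix F n
  have : IsArtinianRing A := IsArtinianRing.of_finite F A
  have : IsArtinianRing Aᵐᵒᵖ := IsArtinianRing.of_finite F Aᵐᵒᵖ
  have hl : HasSmallFlatCovers.{u, w} A := hasSmallFlatCovers_of_isSemiprimaryRing A
  have hr : HasSmallFlatCovers.{u, w} Aᵐᵒᵖ := hasSmallFlatCovers_of_isSemiprimaryRing Aᵐᵒᵖ
  exact ⟨isGPerfectCounterexample_eventuallyConstant (A := A.toSubring) hT hA hl hr,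
    isGPerfectCounterexample_eventuallyConstant hT.pi
      (not_isVonNeumannRegular_eventuallyConstant (A := A.toSubring) hT hA)
      (hasSmallFlatCovers_eventuallyConstant (A := A.toSubring) hT hl)
      (hasSmallFlatCovers_op_eventuallyConstant (A := A.toSubring) hT hr)⟩

/-- The matrix unit `E₁₂` generates a left ideal of square zero, so it lies in the radical. -/
theorem jacobson_upperTriangularTwo_ne_bot (F : Type u) [Field F] :
    Ring.jacobson (upperTriangularTwo F) ≠ ⊥ := by
  intro h
  let x : upperTriangularTwo F := ⟨!![0, 1; 0, 0], rfl⟩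
  have hx : x ∈ Ring.jacobson (upperTriangularTwo F) := by
    rw [← Ideal.jacobson_bot, Ideal.mem_jacobson_iff]
    intro y
    have hxy : x * y * x = 0 := by
      refine Subtype.ext (Matrix.ext fun i j => ?_)
      have hy : y.1 1 0 = 0 := y.2
      change (!![0, 1; 0, 0] * y.1 * !![0, 1; 0, 0] : Matrix (Fin 2) (Fin 2) F) i j = 0
      fin_cases i <;> fin_cases j <;>
        simp [Matrix.mul_apply, Matrix.vecMul, dotProduct, Fin.sum_univ_two, hy]
    refine ⟨1 - y * x, ?_⟩
    rw [Ideal.mem_bot]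
    calc (1 - y * x) * y * x + (1 - y * x) - 1 = -(y * (x * y * x)) := by
          simp only [sub_mul, one_mul, mul_assoc]; abel
      _ = 0 := by rw [hxy, mul_zero, neg_zero]
  rw [h, Ideal.mem_bot] at hx
  have : x.1 0 1 = 0 := by rw [hx]; rfl
  exact one_ne_zero (α := F) this

theorem mainTheorem2 (F : Type u) [Field F] :
    (∀ (S : Type v) [Ring S] [Algebra F S] [FiniteDimensional F S], Ring.jacobson S ≠ ⊥ →
      (∃ ι : S →ₐ[F] Matrix (Fin (Module.finrank F S)) (Fin (Module.finrank F S)) F,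
        Function.Injective ι) ∧
      ∀ (n : ℕ) (ι : S →ₐ[F] Matrix (Fin n) (Fin n) F), Function.Injective ι →
        IsGPerfectCounterexample.{u, w} (eventuallyConstant ι.range.toSubring) ∧
        IsGPerfectCounterexample.{u, w}
          (eventuallyConstant (eventuallyConstant ι.range.toSubring))) ∧
    Ring.jacobson (upperTriangularTwo F) ≠ ⊥ ∧
    IsGPerfectCounterexample.{u, w} (eventuallyConstant (upperTriangularTwo F).toSubring) ∧
    IsGPerfectCounterexample.{u, w}
      (eventuallyConstant (eventuallyConstant (upperTriangularTwo F).toSubring)) := by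
  refine ⟨fun S _ _ _ hS => ⟨⟨Algebra.leftMulMatrix (Module.finBasis F S),
    Algebra.leftMulMatrix_injective _⟩, fun n ι hι => ?_⟩, jacobson_upperTriangularTwo_ne_bot F, ?_⟩
  · refine isGPerfectCounterexample_of_subalgebra ι.range fun h => hS ?_
    let e := (AlgEquiv.ofInjective ι hι).symm
    exact (h.of_surjective (e : ι.range →+* S) e.surjective).jacobson_eq_bot
  · exact isGPerfectCounterexample_of_subalgebra _ fun h =>
      jacobson_upperTriangularTwo_ne_bot F h.jacobson_eq_bot
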